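/- For $n\ge 1$ let $\mathbb{E}^n$ be the $n$-dimensional Euclidean space with norm $|\cdot|$, let $\mathbb{B}^n$ be its closed unit ball, and let $\mathbb{E}^n_+$ be the set of points of $\mathbb{E}^n$ all of whose coordinates are non-negative. Put \[ M_n:=\bigl\{v-w \;\big|\; v,w\in\mathbb{E}^n_+,\ |v|^2+\bigl(|w|+\sqrt2\bigr)^2\le 4\bigr\}, \] and let $U_n$ be the orthogonal projection of $M_{n+1}$ onto the $n$-dimensional subspace $(1,\dots,1)^{\perp}$ of $\mathbb{E}^{n+1}$. Then there exists a positive integer $n_0$ such that \[ \mathrm{Vol}(U_n)<\mathrm{Vol}(0.891\,\mathbb{B}^n)\qquad\text{for all } n\ge n_0, \] where $\mathrm{Vol}$ denotes the $n$-dimensional Euclidean volume (for $U_n$, the one of the hyperplane $(1,\dots,1)^{\perp}\cong\mathbb{E}^n$). -/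

import Mathlib

open scoped Pointwise

noncomputable section

namespace ConstWidth

/-- The body `M_n = {v - w : v, w ∈ 𝔼ⁿ₊, |v|² + (|w| + √2)² ≤ 4}`, where `𝔼ⁿ₊` is the set of points
of Euclidean space all of whose coordinates are non-negative. -/
def M (n : ℕ) : Set (EuclideanSpace ℝ (Fin n)) :=
  {x | ∃ v w : EuclideanSpace ℝ (Fin n), (∀ i, 0 ≤ v i) ∧ (∀ i, 0 ≤ w i) ∧
    ‖v‖ ^ 2 + (‖w‖ + Real.sqrt 2) ^ 2 ≤ 4 ∧ x = v - w}

/-- The diagonal vector `(1, …, 1)`. -/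
def diag (n : ℕ) : EuclideanSpace ℝ (Fin n) := WithLp.toLp 2 (fun _ => 1)

/-- The hyperplane `(1, …, 1)^⊥` of `𝔼ⁿ⁺¹`, an `n`-dimensional Euclidean space. -/
def diagPerp (n : ℕ) : Submodule ℝ (EuclideanSpace ℝ (Fin (n + 1))) :=
  (Submodule.span ℝ {diag (n + 1)})ᗮ

/-- The body `U_n`: the orthogonal projection of `M_{n+1}` onto `(1, …, 1)^⊥`. -/
def U (n : ℕ) : Set (diagPerp n) :=
  (fun x => (diagPerp n).orthogonalProjectionOnto x) '' M (n + 1)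

/-- The Euclidean volume on a linear subspace `H` of `𝔼ⁿ`, in the dimension of `H`: Lebesgue measure
of the inner product space `H`, for which the unit cube of an orthonormal basis of `H` has volume
one (not the restriction of the full-dimensional volume of the ambient space). -/
def subspaceVolume {n : ℕ} (H : Submodule ℝ (EuclideanSpace ℝ (Fin n))) :
    MeasureTheory.Measure H :=
  (measureSpaceOfInnerProductSpace (E := H)).volume

end ConstWidth

end

/-!
The exponential rate of `vol U_n` is that of `vol M_{n+1}`, because projecting along the diagonal
costs only a constant factor: moving a point of `M_{n+1}` by at most `10⁻⁶` in the direction of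
`(1, …, 1)` decreases its negative part and hardly changes its norm, so that every fiber of a slight
enlargement of `M_{n+1}` over `U_n` contains a segment of length `10⁻⁶`
(`ofReal_mul_volume_orthogonalProjection_le`, `add_smul_mem_iUnion_coverSet`).

In the definition of `M` one may take for `v` and `w` the positive and the negative part of `x`, so
`M = {|x₊|² + |x₋|² + 2√2 |x₋| ≤ 2}`. Its volume is bounded by covering it with five asymmetric
ellipsoids `p⁻²|x₊|² + q⁻²|x₋|² ≤ E + 1/2`, one for each of five intervals of values of `s = |x₋|`
(`mem_iUnion_coverSet`). On `M` the left-hand side is at most `p⁻²(2 - 2√2 s - s²) + q⁻² s²`, which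
for `q ≤ p` is a convex function of `s`, so only the ends of the intervals have to be tested. By the
exponential Chebyshev inequality against a two-sided Gaussian density, such an ellipsoid in dimension
`N` has volume at most `(exp (E + 1/2) (p + q) / 2 · √(π / N)) ^ N`
(`volume_asymmetric_ellipsoid_le`), whereas a ball of radius `r` has volume `(r √(2πe / N)) ^ N` up
to a polynomial factor (`Gamma_sq_le`). The five choices of `(p, q, E)` all give a radius below
`0.8909 < 0.891`, and the gap absorbs constants and polynomial factors
(`eventually_mul_pow_lt_volume_ball`).
-/

open MeasureTheory Set

namespace ConstWidth

/-! ### Volume of a projection along a line -/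

/-- If every fiber of `S` over a point of `T` contains a segment of length `r`, then `vol T` is at
most `vol S / r`. Markov's inequality for the measurable function that sends `y` to the length of
its fiber makes measurability of `T` unnecessary. -/
theorem ofReal_mul_volume_le_of_segment_fibers {F G : Type*}
    [NormedAddCommGroup F] [InnerProductSpace ℝ F] [FiniteDimensional ℝ F]
    [MeasurableSpace F] [BorelSpace F]
    [NormedAddCommGroup G] [InnerProductSpace ℝ G] [FiniteDimensional ℝ G]
    [MeasurableSpace G] [BorelSpace G]
    (f : ℝ ≃ₗᵢ[ℝ] G) (r : ℝ) {S : Set (G × F)} (hS : MeasurableSet S) {T : Set F}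
    (hT : ∀ y ∈ T, ∃ z, ∀ t ∈ Icc 0 r, (z + f t, y) ∈ S) :
    ENNReal.ofReal r * volume T ≤ (volume.prod volume) S := by
  have hm : Measurable fun y : F => (volume : Measure G) ((fun z => (z, y)) ⁻¹' S) :=
    measurable_measure_prodMk_right hS
  have hsub : T ⊆ {y | ENNReal.ofReal r ≤ (volume : Measure G) ((fun z => (z, y)) ⁻¹' S)} := by
    intro y hy
    obtain ⟨z, hz⟩ := hT y hy
    have hmp : MeasurePreserving (fun t => z + f t) volume volume :=
      (measurePreserving_add_left volume z).comp f.measurePreserving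
    have hmeas : MeasurableSet ((fun z => (z, y)) ⁻¹' S) := measurable_prodMk_right hS
    show ENNReal.ofReal r ≤ volume ((fun z => (z, y)) ⁻¹' S)
    rw [← hmp.measure_preimage hmeas.nullMeasurableSet]
    calc ENNReal.ofReal r = volume (Icc 0 r) := by simp
      _ ≤ _ := measure_mono fun t ht => hz t ht
  calc ENNReal.ofReal r * volume T
      ≤ ENNReal.ofReal r *
        volume {y | ENNReal.ofReal r ≤ (volume : Measure G) ((fun z => (z, y)) ⁻¹' S)} := by gcongr
    _ ≤ ∫⁻ y, (volume : Measure G) ((fun z => (z, y)) ⁻¹' S) := mul_meas_ge_le_lintegral hm _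
    _ = (volume.prod volume) S := (Measure.prod_apply_symm hS).symm

/-- A set whose points all start a segment of length `r` in the direction of the line `K` inside
`S` projects along `K` to a set of volume at most `vol S / r`. -/
theorem ofReal_mul_volume_orthogonalProjection_le {E : Type*}
    [NormedAddCommGroup E] [InnerProductSpace ℝ E] [FiniteDimensional ℝ E]
    [MeasurableSpace E] [BorelSpace E] (K : Submodule ℝ E) (hK : Module.finrank ℝ K = 1)
    (e : K) (he : ‖e‖ = 1) (r : ℝ) {S T : Set E} (hS : MeasurableSet S)
    (hT : ∀ x ∈ T, ∀ t ∈ Icc (0 : ℝ) r, x + t • (e : E) ∈ S) :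
    ENNReal.ofReal r * (measureSpaceOfInnerProductSpace (E := Kᗮ)).volume
      ((fun x => Kᗮ.orthogonalProjectionOnto x) '' T) ≤ volume S := by
  let f : ℝ ≃ₗᵢ[ℝ] K := (LinearIsometry.toSpanSingleton ℝ K he).toLinearIsometryEquiv (by simp [hK])
  have hf : ∀ t, f t = t • e := fun t => by simp [f]
  let ψ : K × Kᗮ → E := fun z => K.orthogonalDecomposition.symm (WithLp.toLp 2 z)
  have hψ : MeasurePreserving ψ (volume.prod volume) volume :=
    K.orthogonalDecomposition.symm.measurePreserving.comp (WithLp.volume_preserving_toLp _ _)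
  rw [← hψ.measure_preimage hS.nullMeasurableSet]
  refine ofReal_mul_volume_le_of_segment_fibers f r (hψ.measurable hS) ?_
  rintro _ ⟨x, hx, rfl⟩
  refine ⟨K.orthogonalProjectionOnto x, fun t ht => ?_⟩
  have hx_eq : x = (K.orthogonalProjectionOnto x : E) + Kᗮ.orthogonalProjectionOnto x := by
    simp
  have key : ψ (K.orthogonalProjectionOnto x + f t, Kᗮ.orthogonalProjectionOnto x)
      = x + t • (e : E) := by
    conv_rhs => rw [hx_eq]
    simp only [ψ, Submodule.orthogonalDecomposition_symm_apply, hf]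
    show (K.orthogonalProjectionOnto x : E) + t • (e : E) + Kᗮ.orthogonalProjectionOnto x = _
    abel
  show ψ _ ∈ S
  rw [key]
  exact hT x hx t ht

/-! ### Gaussian bound for the volume of an asymmetric ellipsoid -/

/-- The square `|x₊|²` of the norm of the positive part of `x`. -/
noncomputable def sqPos {n : ℕ} (x : EuclideanSpace ℝ (Fin n)) : ℝ := ∑ i, max (x i) 0 ^ 2

/-- The square `|x₋|²` of the norm of the negative part of `x`. -/
noncomputable def sqNeg {n : ℕ} (x : EuclideanSpace ℝ (Fin n)) : ℝ := ∑ i, max (-x i) 0 ^ 2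

theorem continuous_sqPos {n : ℕ} : Continuous (sqPos (n := n)) := by
  unfold sqPos; fun_prop

theorem continuous_sqNeg {n : ℕ} : Continuous (sqNeg (n := n)) := by
  unfold sqNeg; fun_prop

theorem integrable_two_sided_gaussian {a b : ℝ} (ha : 0 < a) (hb : 0 < b) :
    Integrable fun t : ℝ => Real.exp (-(a * max t 0 ^ 2 + b * max (-t) 0 ^ 2)) := by
  refine (integrable_exp_neg_mul_sq (lt_min ha hb)).mono' (by fun_prop) (.of_forall fun t => ?_)
  rw [Real.norm_eq_abs, Real.abs_exp, Real.exp_le_exp]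
  rcases le_total 0 t with ht | ht
  · rw [max_eq_left ht, max_eq_right (by linarith)]
    nlinarith [min_le_left a b, sq_nonneg t]
  · rw [max_eq_right ht, max_eq_left (by linarith)]
    nlinarith [min_le_right a b, sq_nonneg t]

theorem integral_two_sided_gaussian {a b : ℝ} (ha : 0 < a) (hb : 0 < b) :
    ∫ t : ℝ, Real.exp (-(a * max t 0 ^ 2 + b * max (-t) 0 ^ 2))
      = √(Real.pi / a) / 2 + √(Real.pi / b) / 2 := by
  have hi := integrable_two_sided_gaussian ha hb
  rw [← intervalIntegral.integral_Iic_add_Ioi (b := 0) hi.integrableOn hi.integrableOn, add_comm]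
  congr 1
  · rw [← integral_gaussian_Ioi a]
    refine setIntegral_congr_fun measurableSet_Ioi fun t ht => ?_
    have ht : 0 < t := ht
    simp only [max_eq_left ht.le, max_eq_right (neg_nonpos.2 ht.le)]
    congr 1
    ring
  · have h := integral_comp_neg_Iic 0 fun t => Real.exp (-b * t ^ 2)
    rw [neg_zero] at h
    rw [← integral_gaussian_Ioi b, ← h]
    refine setIntegral_congr_fun measurableSet_Iic fun t ht => ?_
    have ht : t ≤ 0 := ht
    simp only [max_eq_right ht, max_eq_left (neg_nonneg.2 ht)]
    congr 1
    ring

/-- Exponential Chebyshev bound for the body `a|x₊|² + b|x₋|² ≤ E`, with `a = p⁻²`, `b = q⁻²`: its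
indicator is at most `exp (n (E - a|x₊|² - b|x₋|²))`, whose integral factors over the coordinates. -/
theorem volume_asymmetric_ellipsoid_le {n : ℕ} (hn : 0 < n) {p q : ℝ} (hp : 0 < p) (hq : 0 < q)
    (E : ℝ) :
    volume {x : EuclideanSpace ℝ (Fin n) | (p ^ 2)⁻¹ * sqPos x + (q ^ 2)⁻¹ * sqNeg x ≤ E}
      ≤ ENNReal.ofReal ((Real.exp E * (p + q) / 2 * √(Real.pi / n)) ^ n) := by
  have hn' : (0 : ℝ) < n := by exact_mod_cast hn
  set a := n * (p ^ 2)⁻¹ with ha_def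
  set b := n * (q ^ 2)⁻¹ with hb_def
  have ha : 0 < a := by positivity
  have hb : 0 < b := by positivity
  let g : ℝ → ℝ := fun t => Real.exp (-(a * max t 0 ^ 2 + b * max (-t) 0 ^ 2))
  have hg : Measurable g := by fun_prop
  have hint : Integrable fun x : Fin n → ℝ => ∏ i, g (x i) :=
    Integrable.fintype_prod fun _ => integrable_two_sided_gaussian ha hb
  have hval : ∫ x : Fin n → ℝ, ∏ i, g (x i) = ((p + q) / 2 * √(Real.pi / n)) ^ n := by
    rw [integral_fintype_prod_volume_eq_pow, integral_two_sided_gaussian ha hb, Fintype.card_fin]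
    have h1 : ∀ s : ℝ, 0 < s → √(Real.pi / (n * (s ^ 2)⁻¹)) = s * √(Real.pi / n) := by
      intro s hs
      rw [show Real.pi / (n * (s ^ 2)⁻¹) = s ^ 2 * (Real.pi / n) by field_simp,
        Real.sqrt_mul (by positivity), Real.sqrt_sq hs.le]
    rw [ha_def, hb_def, h1 p hp, h1 q hq]
    ring
  have hprod : ∀ x : EuclideanSpace ℝ (Fin n),
      ∏ i, g (x i) = Real.exp (-(n * ((p ^ 2)⁻¹ * sqPos x + (q ^ 2)⁻¹ * sqNeg x))) := by
    intro x
    rw [← Real.exp_sum, sqPos, sqNeg, Finset.sum_neg_distrib, Finset.sum_add_distrib,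
      ← Finset.mul_sum, ← Finset.mul_sum, mul_add, ha_def, hb_def, mul_assoc, mul_assoc]
  have hlint : ∫⁻ x : EuclideanSpace ℝ (Fin n), ENNReal.ofReal (∏ i, g (x i))
      = ENNReal.ofReal (((p + q) / 2 * √(Real.pi / n)) ^ n) := by
    have hm : Measurable fun x : Fin n → ℝ => ENNReal.ofReal (∏ i, g (x i)) := by fun_prop
    rw [← hval, ofReal_integral_eq_lintegral_ofReal hint
      (.of_forall fun x => Finset.prod_nonneg fun i _ => (Real.exp_pos _).le)]
    exact (PiLp.volume_preserving_ofLp (Fin n)).lintegral_comp hm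
  have hm : Measurable fun x : EuclideanSpace ℝ (Fin n) => ENNReal.ofReal (∏ i, g (x i)) := by
    fun_prop
  have hsub : {x : EuclideanSpace ℝ (Fin n) | (p ^ 2)⁻¹ * sqPos x + (q ^ 2)⁻¹ * sqNeg x ≤ E}
      ⊆ {x | ENNReal.ofReal (Real.exp (-(n * E))) ≤ ENNReal.ofReal (∏ i, g (x i))} := by
    intro x hx
    have hx : (p ^ 2)⁻¹ * sqPos x + (q ^ 2)⁻¹ * sqNeg x ≤ E := hx
    have hle : Real.exp (-(n * E)) ≤ ∏ i, g (x i) := by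
      rw [hprod, Real.exp_le_exp]
      gcongr
    exact ENNReal.ofReal_le_ofReal hle
  have hmarkov := mul_meas_ge_le_lintegral (μ := volume) hm (ENNReal.ofReal (Real.exp (-(n * E))))
  rw [hlint] at hmarkov
  have hexp : ENNReal.ofReal (Real.exp (n * E)) * ENNReal.ofReal (Real.exp (-(n * E))) = 1 := by
    rw [← ENNReal.ofReal_mul (Real.exp_pos _).le, ← Real.exp_add, add_neg_cancel, Real.exp_zero,
      ENNReal.ofReal_one]
  calc _ ≤ volume {x : EuclideanSpace ℝ (Fin n) |
          ENNReal.ofReal (Real.exp (-(n * E))) ≤ ENNReal.ofReal (∏ i, g (x i))} := measure_mono hsub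
    _ = ENNReal.ofReal (Real.exp (n * E)) * (ENNReal.ofReal (Real.exp (-(n * E))) * _) := by
        rw [← mul_assoc, hexp, one_mul]
    _ ≤ ENNReal.ofReal (Real.exp (n * E)) *
          ENNReal.ofReal (((p + q) / 2 * √(Real.pi / n)) ^ n) := by gcongr
    _ = _ := by
        rw [← ENNReal.ofReal_mul (Real.exp_pos _).le, Real.exp_nat_mul, ← mul_pow]
        congr 2
        ring

/-! ### Stirling bound for the volume of the ball -/

/-- Duplication formula and Stirling's bound: up to a polynomial factor, `Γ (n / 2 + 1)` is at most
`(N / (2e)) ^ (N / 2)` with `N = n + 1`. -/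
theorem Gamma_sq_le {n : ℕ} (hn : 2 ≤ n) :
    Real.Gamma (n / 2 + 1) ^ 2 ≤ √Real.pi * Real.exp 1 * (n + 1) *
      ((n + 1) / (2 * Real.exp 1)) ^ (n + 1) := by
  have hn' : (2 : ℝ) ≤ n := by exact_mod_cast hn
  have hmono : Real.Gamma (n / 2 + 1) ≤ Real.Gamma (n / 2 + 1 + 1 / 2) :=
    Real.Gamma_strictMonoOn_Ici.monotoneOn (by simp; linarith) (by simp; linarith) (by linarith)
  have hpos : 0 < Real.Gamma (n / 2 + 1) := Real.Gamma_pos_of_pos (by linarith)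
  have hdup := Real.Gamma_mul_Gamma_add_half (n / 2 + 1)
  rw [show (2 : ℝ) * (n / 2 + 1) = (n + 1 : ℕ) + 1 by push_cast; ring, Real.Gamma_nat_eq_factorial,
    show (1 : ℝ) - ((n + 1 : ℕ) + 1) = -(n + 1 : ℕ) by ring, Real.rpow_neg (by norm_num),
    Real.rpow_natCast] at hdup
  -- Stirling's sequence is decreasing, so that it is bounded by its first term `e / √2`.
  have hst : Stirling.stirlingSeq (n + 1) ≤ Stirling.stirlingSeq 1 :=
    Stirling.stirlingSeq'_antitone (Nat.zero_le n)
  rw [Stirling.stirlingSeq_one, Stirling.stirlingSeq, div_le_iff₀ (by positivity)] at hst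
  have hsq : √((n + 1 : ℕ) : ℝ) ≤ n + 1 := by
    rw [Real.sqrt_le_left (by positivity)]
    push_cast
    nlinarith
  have hfac : ((n + 1).factorial : ℝ) ≤ Real.exp 1 * (n + 1) * ((n + 1) / Real.exp 1) ^ (n + 1) := by
    refine hst.trans ?_
    rw [Real.sqrt_mul (by norm_num), show Real.exp 1 / √2 * (√2 * √((n + 1 : ℕ) : ℝ) *
      (((n + 1 : ℕ) : ℝ) / Real.exp 1) ^ (n + 1)) = Real.exp 1 * √((n + 1 : ℕ) : ℝ) *
      (((n + 1 : ℕ) : ℝ) / Real.exp 1) ^ (n + 1) by field_simp]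
    push_cast at hsq ⊢
    gcongr
  calc Real.Gamma (n / 2 + 1) ^ 2
      ≤ Real.Gamma (n / 2 + 1) * Real.Gamma (n / 2 + 1 + 1 / 2) := by rw [sq]; gcongr
    _ = ((n + 1).factorial : ℝ) * (2 ^ (n + 1))⁻¹ * √Real.pi := hdup
    _ ≤ Real.exp 1 * (n + 1) * ((n + 1) / Real.exp 1) ^ (n + 1) * (2 ^ (n + 1))⁻¹ * √Real.pi := by
        gcongr
    _ = _ := by
        rw [div_pow, div_pow, mul_pow]
        field_simp

/-- A body of volume at most a constant times `(c √(2πe / N)) ^ N`, with `N = n + 1` and `c < d`, is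
eventually smaller than the `n`-dimensional ball of radius `d`. -/
theorem eventually_mul_pow_lt_volume_ball {c d : ℝ} (hc : 0 < c) (hcd : c < d) {C : ℝ}
    (hC : 0 < C) :
    ∀ᶠ n : ℕ in Filter.atTop,
      C * (c * √(2 * Real.pi * Real.exp 1 / (n + 1))) ^ (n + 1)
        < d ^ n * (√Real.pi ^ n / Real.Gamma (n / 2 + 1)) := by
  have hd : 0 < d := hc.trans hcd
  set ρ := (c / d) ^ 2
  have hρ : |ρ| < 1 := by
    rw [abs_of_nonneg (by positivity)]
    exact pow_lt_one₀ (by positivity) ((div_lt_one hd).2 hcd) (by norm_num)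
  have hlim := (tendsto_pow_const_mul_const_pow_of_abs_lt_one 1 hρ).comp
    (Filter.tendsto_add_atTop_nat 1)
  set A := C ^ 2 * (d ^ 2 * Real.pi) * (√Real.pi * Real.exp 1) with hA
  have hApos : 0 < A := by positivity
  have hev := hlim.eventually (gt_mem_nhds (show (0 : ℝ) < 1 / A by positivity))
  filter_upwards [hev, Filter.eventually_ge_atTop 2] with n h1 hn
  have hG := Gamma_sq_le hn
  have hGpos : 0 < Real.Gamma (n / 2 + 1) := Real.Gamma_pos_of_pos (by positivity)
  simp only [Function.comp_apply, pow_one, Nat.cast_add, Nat.cast_one] at h1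
  rw [lt_div_iff₀ hApos] at h1
  rw [← mul_div_assoc, lt_div_iff₀ hGpos, ← mul_pow]
  -- Squaring makes the bound of `Gamma_sq_le` applicable, whose factor `N ^ N` cancels.
  refine lt_of_pow_lt_pow_left₀ 2 (by positivity) ?_
  have hs : √(2 * Real.pi * Real.exp 1 / (n + 1)) ^ 2 = 2 * Real.pi * Real.exp 1 / (n + 1) :=
    Real.sq_sqrt (by positivity)
  calc (C * (c * √(2 * Real.pi * Real.exp 1 / (n + 1))) ^ (n + 1) * Real.Gamma (n / 2 + 1)) ^ 2
      = C ^ 2 * (c ^ 2 * (2 * Real.pi * Real.exp 1 / (n + 1))) ^ (n + 1) *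
          Real.Gamma (n / 2 + 1) ^ 2 := by
        rw [mul_pow, mul_pow C, ← pow_mul, mul_comm (n + 1) 2, pow_mul, mul_pow c, hs]
    _ ≤ C ^ 2 * (c ^ 2 * (2 * Real.pi * Real.exp 1 / (n + 1))) ^ (n + 1) *
          (√Real.pi * Real.exp 1 * (n + 1) * ((n + 1) / (2 * Real.exp 1)) ^ (n + 1)) := by gcongr
    _ = C ^ 2 * (√Real.pi * Real.exp 1) * (n + 1) * ((c ^ 2 * (2 * Real.pi * Real.exp 1 / (n + 1))) *
          ((n + 1) / (2 * Real.exp 1))) ^ (n + 1) := by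
        rw [mul_pow _ ((n + 1 : ℝ) / (2 * Real.exp 1))]; ring
    _ = C ^ 2 * (√Real.pi * Real.exp 1) * (n + 1) * (ρ * (d ^ 2 * Real.pi)) ^ (n + 1) := by
        congr 2
        simp only [ρ]
        field_simp
    _ = ((n + 1) * ρ ^ (n + 1) * A) * (d ^ 2 * Real.pi) ^ n := by
        rw [hA, mul_pow, pow_succ (d ^ 2 * Real.pi)]; ring
    _ < 1 * (d ^ 2 * Real.pi) ^ n := by gcongr
    _ = ((d * √Real.pi) ^ n) ^ 2 := by
        rw [one_mul, ← pow_mul, mul_comm n 2, pow_mul, mul_pow d, Real.sq_sqrt Real.pi_pos.le]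

/-! ### Covering a neighbourhood of the body by asymmetric ellipsoids -/

theorem sqPos_nonneg {n : ℕ} (x : EuclideanSpace ℝ (Fin n)) : 0 ≤ sqPos x :=
  Finset.sum_nonneg fun _ _ => sq_nonneg _

theorem sqNeg_nonneg {n : ℕ} (x : EuclideanSpace ℝ (Fin n)) : 0 ≤ sqNeg x :=
  Finset.sum_nonneg fun _ _ => sq_nonneg _

theorem sqPos_add_sqNeg {n : ℕ} (x : EuclideanSpace ℝ (Fin n)) : sqPos x + sqNeg x = ‖x‖ ^ 2 := by
  rw [EuclideanSpace.norm_sq_eq, sqPos, sqNeg, ← Finset.sum_add_distrib]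
  refine Finset.sum_congr rfl fun i _ => ?_
  rw [Real.norm_eq_abs, sq_abs]
  rcases le_total 0 (x i) with h | h
  · rw [max_eq_left h, max_eq_right (neg_nonpos.2 h)]; ring
  · rw [max_eq_right h, max_eq_left (neg_nonneg.2 h)]; ring

/-- Replacing `v` and `w` by the positive and the negative part of `v - w` only decreases norms. -/
theorem sqPos_add_sqNeg_add_le_of_mem_M {n : ℕ} {x : EuclideanSpace ℝ (Fin n)} (hx : x ∈ M n) :
    sqPos x + sqNeg x + 2 * √2 * √(sqNeg x) ≤ 2 := by
  obtain ⟨v, w, hv, hw, h, rfl⟩ := hx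
  have h1 : sqPos (v - w) ≤ ‖v‖ ^ 2 := by
    rw [EuclideanSpace.norm_sq_eq]
    refine Finset.sum_le_sum fun i _ => ?_
    rw [Real.norm_eq_abs, sq_abs]
    gcongr
    have := hw i
    exact max_le (by simp; linarith) (hv i)
  have h2 : sqNeg (v - w) ≤ ‖w‖ ^ 2 := by
    rw [EuclideanSpace.norm_sq_eq]
    refine Finset.sum_le_sum fun i _ => ?_
    rw [Real.norm_eq_abs, sq_abs]
    gcongr
    have := hv i
    exact max_le (by simp; linarith) (hw i)
  have h3 : √(sqNeg (v - w)) ≤ ‖w‖ := Real.sqrt_le_left (norm_nonneg w) |>.2 h2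
  have h4 : √2 ^ 2 = (2 : ℝ) := Real.sq_sqrt (by norm_num)
  nlinarith [Real.sqrt_nonneg 2, norm_nonneg w]

/-- The value `E` bounds the convex function `a (K - k s - s²) + b s²` of `s` at the ends of an
interval, hence on the interval. -/
theorem mul_add_mul_sq_le_of_endpoints {a b k K E s s₀ s₁ P : ℝ} (ha : 0 ≤ a) (hab : a ≤ b)
    (hs : s₀ < s₁) (h₀ : s₀ ≤ s) (h₁ : s ≤ s₁) (hP : P + s ^ 2 + k * s ≤ K)
    (hE₀ : a * (K - k * s₀ - s₀ ^ 2) + b * s₀ ^ 2 ≤ E)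
    (hE₁ : a * (K - k * s₁ - s₁ ^ 2) + b * s₁ ^ 2 ≤ E) :
    a * P + b * s ^ 2 ≤ E := by
  have h : a * P ≤ a * (K - k * s - s ^ 2) := by gcongr; linarith
  have e₀ := mul_le_mul_of_nonneg_left hE₀ (sub_nonneg.2 h₁)
  have e₁ := mul_le_mul_of_nonneg_left hE₁ (sub_nonneg.2 h₀)
  have e₂ : 0 ≤ (s₁ - s₀) * ((b - a) * ((s - s₀) * (s₁ - s))) :=
    mul_nonneg (sub_nonneg.2 hs.le)
      (mul_nonneg (sub_nonneg.2 hab) (mul_nonneg (sub_nonneg.2 h₀) (sub_nonneg.2 h₁)))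
  have : 0 ≤ (s₁ - s₀) * (E - (a * (K - k * s - s ^ 2) + b * s ^ 2)) := by linarith
  have := nonneg_of_mul_nonneg_right this (sub_pos.2 hs)
  linarith

/-- The exponential factor `exp (E + 1/2) (p + q) / 2` of an asymmetric ellipsoid is at most
`r √(2e)`, that of a ball of radius `r`, the hypothesis being stated
with a rational upper bound for `exp E` and the lower bound `2.828427` for `2√2`. -/
theorem exp_mul_add_le {E p q r : ℝ} (hE : |E| ≤ 1) (hpq : 0 ≤ p + q) (hr : 0 ≤ r)
    (h : (1 + E + E ^ 2 / 2 + |E| ^ 3 * (2 / 9)) * (p + q) ≤ 2.828427 * r) :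
    Real.exp (E + 1 / 2) * (p + q) / 2 ≤ r * √(2 * Real.exp 1) := by
  -- Taylor's formula to second order; `2 / 9 = (3 + 1) / (3! * 3)` is the constant of the remainder.
  have hexp := (abs_le.1 (Real.exp_bound hE (n := 3) (by norm_num))).2
  norm_num [Finset.sum_range_succ, Nat.factorial] at hexp
  have h2 : (1.4142135 : ℝ) ≤ √2 := Real.le_sqrt_of_sq_le (by norm_num)
  have hhalf : √(Real.exp 1) = Real.exp (1 / 2) := (Real.exp_half 1).symm
  rw [Real.sqrt_mul (by norm_num), hhalf, Real.exp_add]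
  have hmain : Real.exp E * (p + q) ≤ 2 * r * √2 := by
    calc Real.exp E * (p + q) ≤ (1 + E + E ^ 2 / 2 + |E| ^ 3 * (2 / 9)) * (p + q) := by
          gcongr; linarith
      _ ≤ 2.828427 * r := h
      _ ≤ 2 * r * √2 := by nlinarith
  nlinarith [Real.exp_pos (1 / 2)]

/-- The parameters `(p, q, E)` of the covering ellipsoids. Each is adapted to one interval of
values of `|x₋|`, the intervals being cut at `0.203`, `0.26`, `0.28`, `0.33`. -/
def coverParams : Fin 5 → ℝ × ℝ × ℝ
  | 0 => (2.01, 0.52, -0.00487)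
  | 1 => (1.84, 0.69, -0.00444)
  | 2 => (1.8, 0.72, -0.0001)
  | 3 => (1.78, 0.75, -0.00407)
  | 4 => (1.67, 0.83, 0.0015)

/-- The ellipsoid `p⁻²|x₊|² + q⁻²|x₋|² ≤ E + 1/2` with the `j`-th parameters. -/
def coverSet (n : ℕ) (j : Fin 5) : Set (EuclideanSpace ℝ (Fin n)) :=
  {x | ((coverParams j).1 ^ 2)⁻¹ * sqPos x + ((coverParams j).2.1 ^ 2)⁻¹ * sqNeg x
    ≤ (coverParams j).2.2 + 1 / 2}

theorem isClosed_coverSet (n : ℕ) (j : Fin 5) : IsClosed (coverSet n j) :=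
  isClosed_le ((continuous_const.mul continuous_sqPos).add (continuous_const.mul continuous_sqNeg))
    continuous_const

theorem volume_coverSet_le {n : ℕ} (hn : 0 < n) (j : Fin 5) :
    volume (coverSet n j)
      ≤ ENNReal.ofReal ((0.8909 * √(2 * Real.pi * Real.exp 1 / n)) ^ n) := by
  have hn' : (0 : ℝ) < n := by exact_mod_cast hn
  have hpq : 0 < (coverParams j).1 ∧ 0 < (coverParams j).2.1 := by
    fin_cases j <;> norm_num [coverParams]
  have hexp : Real.exp ((coverParams j).2.2 + 1 / 2) * ((coverParams j).1 + (coverParams j).2.1) / 2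
      ≤ 0.8909 * √(2 * Real.exp 1) := by
    refine exp_mul_add_le ?_ (by linarith [hpq.1, hpq.2]) (by norm_num) ?_ <;>
    · fin_cases j <;> norm_num [coverParams, abs_of_pos, abs_of_neg]
  refine (volume_asymmetric_ellipsoid_le hn hpq.1 hpq.2 _).trans (ENNReal.ofReal_le_ofReal ?_)
  have hpos : 0 ≤ (coverParams j).1 + (coverParams j).2.1 := by linarith [hpq.1, hpq.2]
  calc _ ≤ (0.8909 * √(2 * Real.exp 1) * √(Real.pi / n)) ^ n := by gcongr
    _ = _ := by
        rw [mul_assoc, ← Real.sqrt_mul (by positivity)]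
        congr 3
        ring

/-- The excess `4e-6` over the constant `2` of the body `M n` leaves room for translations along the
diagonal. The intervals of values of `|x₋|` end at `0.586`, just above the largest value `2 - √2`
which is possible in `M n`. -/
theorem mem_iUnion_coverSet {n : ℕ} {x : EuclideanSpace ℝ (Fin n)}
    (hx : sqPos x + sqNeg x + 2 * √2 * √(sqNeg x) ≤ 2 + 4e-6) : x ∈ ⋃ j, coverSet n j := by
  have hP := sqPos_nonneg x
  set s := √(sqNeg x) with hs_def
  have hs : 0 ≤ s := Real.sqrt_nonneg _
  have hQ : sqNeg x = s ^ 2 := (Real.sq_sqrt (sqNeg_nonneg x)).symm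
  have h2 : (1.4142135 : ℝ) ≤ √2 := Real.le_sqrt_of_sq_le (by norm_num)
  have hx' : sqPos x + s ^ 2 + 2.828427 * s ≤ 2.000004 := by
    rw [hQ] at hx
    nlinarith
  have hs1 : s ≤ 0.586 := by
    by_contra! h
    nlinarith
  simp only [mem_iUnion, coverSet, mem_ofPred_eq, hQ]
  rcases le_total s 0.203 with h1 | h1
  · refine ⟨0, mul_add_mul_sq_le_of_endpoints ?_ ?_ ?_ hs h1 hx' ?_ ?_⟩ <;>
    norm_num [coverParams]
  rcases le_total s 0.26 with h2 | h2
  · refine ⟨1, mul_add_mul_sq_le_of_endpoints ?_ ?_ ?_ h1 h2 hx' ?_ ?_⟩ <;>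
    norm_num [coverParams]
  rcases le_total s 0.28 with h3 | h3
  · refine ⟨2, mul_add_mul_sq_le_of_endpoints ?_ ?_ ?_ h2 h3 hx' ?_ ?_⟩ <;>
    norm_num [coverParams]
  rcases le_total s 0.33 with h4 | h4
  · refine ⟨3, mul_add_mul_sq_le_of_endpoints ?_ ?_ ?_ h3 h4 hx' ?_ ?_⟩ <;>
    norm_num [coverParams]
  · refine ⟨4, mul_add_mul_sq_le_of_endpoints ?_ ?_ ?_ h4 hs1 hx' ?_ ?_⟩ <;>
    norm_num [coverParams]

/-- A small translation in a non-negative direction does not increase `|x₋|`, and increases `|x|²`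
by little, so it keeps the points of `M n` inside the union of the covering ellipsoids. -/
theorem add_smul_mem_iUnion_coverSet {n : ℕ} {x e : EuclideanSpace ℝ (Fin n)} (hx : x ∈ M n)
    (he : ‖e‖ = 1) (he0 : ∀ i, 0 ≤ e i) {t : ℝ} (ht : t ∈ Icc (0 : ℝ) 1e-6) :
    x + t • e ∈ ⋃ j, coverSet n j := by
  obtain ⟨ht0, ht1⟩ := ht
  apply mem_iUnion_coverSet
  have hM := sqPos_add_sqNeg_add_le_of_mem_M hx
  rw [sqPos_add_sqNeg] at hM ⊢
  have hneg : sqNeg (x + t • e) ≤ sqNeg x := by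
    refine Finset.sum_le_sum fun i _ => ?_
    gcongr
    simpa using mul_nonneg ht0 (he0 i)
  have hnorm : ‖x + t • e‖ ≤ ‖x‖ + t := by
    simpa [norm_smul, he, abs_of_nonneg ht0] using norm_add_le x (t • e)
  have hQ : √(sqNeg (x + t • e)) ≤ √(sqNeg x) := Real.sqrt_le_sqrt hneg
  have h2 : 0 ≤ √2 := Real.sqrt_nonneg 2
  have hx2 : ‖x‖ ≤ 1.5 := by
    have : 0 ≤ 2 * √2 * √(sqNeg x) := by positivity
    nlinarith [norm_nonneg x]
  have h3 : ‖x + t • e‖ ^ 2 ≤ (‖x‖ + t) ^ 2 := by gcongr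
  have h4 : 2 * √2 * √(sqNeg (x + t • e)) ≤ 2 * √2 * √(sqNeg x) := by gcongr
  nlinarith [norm_nonneg x]

/-! ### The volume of the projected body -/

theorem norm_diag (n : ℕ) : ‖diag n‖ = √n := by
  simp [diag, EuclideanSpace.norm_eq]

theorem ofReal_mul_subspaceVolume_U_le (n : ℕ) :
    ENNReal.ofReal 1e-6 * subspaceVolume (diagPerp n) (U n)
      ≤ ENNReal.ofReal (5 * (0.8909 * √(2 * Real.pi * Real.exp 1 / (n + 1))) ^ (n + 1)) := by
  have hpos : (0 : ℝ) < √(n + 1 : ℕ) := Real.sqrt_pos.2 (by positivity)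
  have hdiag : diag (n + 1) ≠ 0 := by
    rw [← norm_ne_zero_iff, norm_diag]; exact hpos.ne'
  let e : Submodule.span ℝ {diag (n + 1)} :=
    (√(n + 1 : ℕ))⁻¹ • ⟨diag (n + 1), Submodule.mem_span_singleton_self _⟩
  have he_coe : (e : EuclideanSpace ℝ (Fin (n + 1))) = (√(n + 1 : ℕ))⁻¹ • diag (n + 1) := rfl
  have he : ‖e‖ = 1 := by
    rw [Submodule.coe_norm, he_coe, norm_smul, norm_diag, norm_inv, Real.norm_of_nonneg hpos.le,
      inv_mul_cancel₀ hpos.ne']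
  have he_nonneg : ∀ i, 0 ≤ (e : EuclideanSpace ℝ (Fin (n + 1))) i := fun i => by
    rw [he_coe]; simp [diag]
  have hclosed : IsClosed (⋃ j, coverSet (n + 1) j) := isClosed_iUnion_of_finite (isClosed_coverSet _)
  have hproj := ofReal_mul_volume_orthogonalProjection_le (Submodule.span ℝ {diag (n + 1)})
    (finrank_span_singleton hdiag) e he 1e-6 hclosed.measurableSet (T := M (n + 1))
    (fun x hx t ht => add_smul_mem_iUnion_coverSet hx he
      he_nonneg ht)
  refine hproj.trans ?_
  calc volume (⋃ j, coverSet (n + 1) j) ≤ ∑ j, volume (coverSet (n + 1) j) :=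
        measure_iUnion_fintype_le _ _
    _ ≤ ∑ _j : Fin 5, ENNReal.ofReal
          ((0.8909 * √(2 * Real.pi * Real.exp 1 / (n + 1 : ℕ))) ^ (n + 1)) :=
        Finset.sum_le_sum fun j _ => volume_coverSet_le n.succ_pos j
    _ = _ := by
        rw [Finset.sum_const, Finset.card_univ, Fintype.card_fin, nsmul_eq_mul,
          ENNReal.ofReal_mul (by norm_num)]
        push_cast
        simp

theorem volume_smul_closedBall {n : ℕ} (hn : 0 < n) :
    volume ((0.891 : ℝ) • Metric.closedBall (0 : EuclideanSpace ℝ (Fin n)) 1)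
      = ENNReal.ofReal (0.891 ^ n * (√Real.pi ^ n / Real.Gamma (n / 2 + 1))) := by
  have : Nonempty (Fin n) := Fin.pos_iff_nonempty.1 hn
  rw [Measure.addHaar_smul, EuclideanSpace.volume_closedBall, finrank_euclideanSpace,
    Fintype.card_fin, ENNReal.ofReal_one, one_pow, one_mul, abs_of_pos (by positivity),
    ← ENNReal.ofReal_mul (by positivity)]

end ConstWidth

theorem theorem3 :
    ∃ n₀ : ℕ, 0 < n₀ ∧ ∀ n : ℕ, n₀ ≤ n →
      ConstWidth.subspaceVolume (ConstWidth.diagPerp n) (ConstWidth.U n) <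
        MeasureTheory.volume
          ((0.891 : ℝ) • Metric.closedBall (0 : EuclideanSpace ℝ (Fin n)) 1) := by
  have hev := ConstWidth.eventually_mul_pow_lt_volume_ball (c := 0.8909) (d := 0.891) (by norm_num)
    (by norm_num) (C := 5e6) (by norm_num)
  obtain ⟨n₁, hn₁⟩ := Filter.eventually_atTop.1 hev
  refine ⟨n₁ + 1, n₁.succ_pos, fun n hn => ?_⟩
  have hlt := hn₁ n (by omega)
  have hU := ConstWidth.ofReal_mul_subspaceVolume_U_le n
  rw [ConstWidth.volume_smul_closedBall (by omega)]
  have hr : ENNReal.ofReal 1e6 * ENNReal.ofReal 1e-6 = 1 := by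
    rw [← ENNReal.ofReal_mul (by norm_num)]; norm_num
  calc ConstWidth.subspaceVolume (ConstWidth.diagPerp n) (ConstWidth.U n)
      = ENNReal.ofReal 1e6 *
          (ENNReal.ofReal 1e-6 * ConstWidth.subspaceVolume (ConstWidth.diagPerp n) (ConstWidth.U n)) := by
        rw [← mul_assoc, hr, one_mul]
    _ ≤ ENNReal.ofReal 1e6 * ENNReal.ofReal
          (5 * (0.8909 * √(2 * Real.pi * Real.exp 1 / (n + 1))) ^ (n + 1)) := by gcongr
    _ = ENNReal.ofReal (5e6 * (0.8909 * √(2 * Real.pi * Real.exp 1 / (n + 1))) ^ (n + 1)) := by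
        rw [← ENNReal.ofReal_mul (by norm_num), ← mul_assoc]
        norm_num
    _ < _ := (ENNReal.ofReal_lt_ofReal_iff_of_nonneg (by positivity)).2 hlt
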